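/- Let $\mathcal H$ be a finite-dimensional complex Hilbert space and let $\mathbf X$ be a random variable taking values in a set $\mathcal X$. For each $x\in\mathcal X$ let $\sigma_x$ be an operator on $\mathcal H$ with $0\preceq\sigma_x\preceq\lambda I$, where $\lambda\in\mathbb R$ does not depend on $x$ (for instance, a quantum state with $\sigma_x\preceq\lambda I$), and let $\sigma=\mathbb E_{\mathbf X}[\sigma_{\mathbf X}]$. Let $\mathbf X[1],\dots,\mathbf X[M]$ be independent random samples drawn according to the distribution of $\mathbf X$, and let $\tilde\sigma=\frac1M\sum_{m=1}^M\sigma_{\mathbf X[m]}$. Let $\varepsilon,\delta>0$ be such that $\varepsilon<\min\{\frac12,\frac{\lambda}{\delta}\}$. Then $$\Pr\bigl\{\|\tilde\sigma-\sigma\|_1\le\varepsilon\,(\|\sigma\|_1+\delta\dim\mathcal H)\bigr\}\;\ge\;1-2\dim(\mathcal H)\exp\!\left(-\frac{\varepsilon^2M}{2\ln 2}\cdot\frac{\delta}{\lambda+\delta}\right),$$ where $\|A\|_1=\operatorname{Tr}\sqrt{A^\dagger A}$ is the trace norm. -/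

import Mathlib

open MeasureTheory ProbabilityTheory

/-- The trace norm `‖A‖₁ = Tr |A|`, with `|A| = √(A† A)`, of an operator on a
finite-dimensional complex Hilbert space. -/
noncomputable def traceNorm {H : Type*} [NormedAddCommGroup H] [InnerProductSpace ℂ H]
    [CompleteSpace H] (A : H →L[ℂ] H) : ℝ :=
  (LinearMap.trace ℂ H (CFC.abs A : H →L[ℂ] H).toLinearMap).re

/-- The sample average `𝔼_{m ∈ [M]} [A m]` of a tuple of `M` operators. -/
noncomputable def sampleAverage {H : Type*} [NormedAddCommGroup H] [InnerProductSpace ℂ H]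
    {M : ℕ} (A : Fin M → H →L[ℂ] H) : H →L[ℂ] H :=
  (M : ℂ)⁻¹ • ∑ m, A m

/-! Operators are sent to their columns in an orthonormal basis, turning the problem into one about
sums in a Hilbert space. By Cauchy–Schwarz, the trace norm is at most `√d` times the Hilbert–Schmidt
norm, with `d` the dimension.

For centred increments of norm at most 1 and second moment at most `V`, each independent increment
multiplies the expectation of `cosh ‖·‖` by at most `exp V` (`integral_cosh_norm_add_le`). Markov's
inequality then gives the tail `2 * exp (n * V - t)`, free of the dimension.

Since `σ_x² ≤ λ σ_x`, the second moment is at most `λ Tr σ`. The threshold contains `ε Tr σ` as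
well, and under the right scaling the two trace terms cancel, leaving `2 * exp (-ε² M δ / λ)`, which
is stronger than required. -/

open Real in
-- The power series of `cosh √u` in `u` has nonnegative coefficients, so it is convex on `u ≥ 0`.
theorem cosh_sqrt_chord {p q w : ℝ} (hw0 : 0 ≤ w) (hw1 : w ≤ 1) {z : ℝ}
    (hz : z ^ 2 = w * p ^ 2 + (1 - w) * q ^ 2) :
    cosh z ≤ w * cosh p + (1 - w) * cosh q := by
  refine hasSum_le (fun n => ?_) (Real.hasSum_cosh z)
    (((Real.hasSum_cosh p).mul_left w).add ((Real.hasSum_cosh q).mul_left (1 - w)))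
  have h := (convexOn_pow (𝕜 := ℝ) n).2 (Set.mem_Ici.2 (sq_nonneg p)) (Set.mem_Ici.2 (sq_nonneg q)) hw0
    (sub_nonneg.2 hw1) (by ring)
  simp only [smul_eq_mul] at h
  rw [← hz] at h
  simp only [pow_mul, ← mul_div_assoc, ← add_div]
  gcongr

-- The term linear in `d` vanishes on averaging over a centred `d`, and `exp r - r` is `1 + O(r²)`.
open Real in
theorem cosh_norm_add_le {E : Type*} [NormedAddCommGroup E] [InnerProductSpace ℂ E] (x d : E) :
    cosh ‖x + d‖ ≤ cosh ‖x‖ * (exp ‖d‖ - ‖d‖) + sinh ‖x‖ / ‖x‖ * (inner ℂ x d).re := by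
  rcases eq_or_ne x 0 with rfl | hx
  · simp only [zero_add, norm_zero, cosh_zero, one_mul, inner_zero_left, Complex.zero_re, mul_zero,
      add_zero]
    have := Real.self_le_sinh_iff.2 (norm_nonneg d)
    rw [← Real.cosh_add_sinh]
    linarith
  rcases eq_or_ne d 0 with rfl | hd
  · simp
  have ha : 0 < ‖x‖ := norm_pos_iff.2 hx
  have hr : 0 < ‖d‖ := norm_pos_iff.2 hd
  have hc : |(inner ℂ x d).re| ≤ ‖x‖ * ‖d‖ := (Complex.abs_re_le_norm _).trans (norm_inner_le_norm x d)
  have hz := norm_add_sq (𝕜 := ℂ) x d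
  simp only [RCLike.re_to_complex] at hz
  set c := (inner ℂ x d).re
  set a := ‖x‖
  set r := ‖d‖
  obtain ⟨k, hk⟩ : ∃ k, k = c / (a * r) := ⟨_, rfl⟩
  have hck : c = k * (a * r) := by rw [hk]; field_simp
  have hk1 : |k| ≤ 1 := by
    rw [hk, abs_div, abs_of_pos (mul_pos ha hr)]
    exact div_le_one_of_le₀ hc (by positivity)
  rw [abs_le] at hk1
  -- With `k` the cosine of the angle, `‖x + d‖²` interpolates between the aligned value `(a + r)²`
  -- and the opposed value `(a - r)²`.
  have h := cosh_sqrt_chord (p := a + r) (q := a - r) (w := (1 + k) / 2) (z := ‖x + d‖)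
    (by linarith) (by linarith) (by rw [hz, hck]; ring)
  rw [Real.cosh_add, Real.cosh_sub] at h
  have h1 : sinh a / a * c = k * (r * sinh a) := by rw [hck]; field_simp
  rw [h1, ← Real.cosh_add_sinh]
  have h2 : sinh a ≤ cosh a := (Real.sinh_lt_cosh a).le
  have h3 : r ≤ sinh r := Real.self_le_sinh_iff.2 hr.le
  have h4 : 0 ≤ sinh a := Real.sinh_nonneg_iff.2 ha.le
  have h5 : k * (sinh a * (sinh r - r)) ≤ 1 * (cosh a * (sinh r - r)) := by
    have : 0 ≤ sinh r - r := by linarith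
    calc _ ≤ 1 * (sinh a * (sinh r - r)) := by gcongr; exact hk1.2
      _ ≤ _ := by gcongr
  linarith

/-! ### Exponential tail bounds for independent sums in a Hilbert space. -/

section Concentration

variable {E : Type*} [NormedAddCommGroup E] [InnerProductSpace ℂ E] [CompleteSpace E]
  {α : Type*} [MeasurableSpace α] {ν : Measure α} [IsProbabilityMeasure ν] {g : α → E} {V : ℝ}

theorem integral_norm_sub_integral_sq_le (hg : Integrable g ν)
    (hsq : Integrable (fun a => ‖g a‖ ^ 2) ν) :
    ∫ a, ‖g a - ∫ a', g a' ∂ν‖ ^ 2 ∂ν ≤ ∫ a, ‖g a‖ ^ 2 ∂ν := by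
  set c := ∫ a', g a' ∂ν with hc
  have hinner : Integrable (fun a => (inner ℂ c (g a)).re) ν := (hg.const_inner (𝕜 := ℂ) c).re
  have hinner0 : ∫ a, (inner ℂ c (g a)).re ∂ν = ‖c‖ ^ 2 := by
    have h' := integral_re (hg.const_inner (𝕜 := ℂ) c)
    simp only [RCLike.re_to_complex] at h'
    rw [h', integral_inner (𝕜 := ℂ) hg c, ← RCLike.re_to_complex, ← hc, inner_self_eq_norm_sq]
  have hexp : ∀ a, ‖g a - c‖ ^ 2 = ‖g a‖ ^ 2 - 2 * (inner ℂ c (g a)).re + ‖c‖ ^ 2 := fun a => by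
    rw [norm_sub_sq (𝕜 := ℂ), inner_re_symm, RCLike.re_to_complex]
  have h1 : Integrable (fun a => ‖g a‖ ^ 2 - 2 * (inner ℂ c (g a)).re) ν :=
    hsq.sub (hinner.const_mul 2)
  simp_rw [hexp]
  rw [integral_add h1 (integrable_const _), integral_sub hsq (hinner.const_mul 2),
    integral_const_mul, hinner0]
  simp only [integral_const, probReal_univ, one_smul]
  linarith [sq_nonneg ‖c‖]

theorem integral_cosh_norm_add_le (hg : StronglyMeasurable g) (hg1 : ∀ a, ‖g a‖ ≤ 1)
    (hmean : ∫ a, g a ∂ν = 0) (hV : ∫ a, ‖g a‖ ^ 2 ∂ν ≤ V) (x : E) :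
    ∫ a, Real.cosh ‖x + g a‖ ∂ν ≤ Real.cosh ‖x‖ * Real.exp V := by
  have hint : Integrable g ν := .of_bound hg.aestronglyMeasurable 1 (.of_forall hg1)
  have hinner : Integrable (fun a => (inner ℂ x (g a)).re) ν := (hint.const_inner (𝕜 := ℂ) x).re
  have hinner0 : ∫ a, (inner ℂ x (g a)).re ∂ν = 0 := by
    have h := integral_inner (𝕜 := ℂ) hint x
    have h' := integral_re (hint.const_inner (𝕜 := ℂ) x)
    simp only [RCLike.re_to_complex] at h'
    rw [h', h, hmean, inner_zero_right, Complex.zero_re]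
  have hsq : Integrable (fun a => ‖g a‖ ^ 2) ν :=
    .of_bound (hg.norm.pow 2).aestronglyMeasurable 1 (.of_forall fun a => by
      rw [norm_pow, norm_norm]; exact pow_le_one₀ (norm_nonneg _) (hg1 a))
  calc ∫ a, Real.cosh ‖x + g a‖ ∂ν
      ≤ ∫ a, (Real.cosh ‖x‖ * (1 + ‖g a‖ ^ 2) +
          Real.sinh ‖x‖ / ‖x‖ * (inner ℂ x (g a)).re) ∂ν := by
        refine integral_mono_of_nonneg (.of_forall fun a => (Real.cosh_pos _).le)
          ((((integrable_const 1).add hsq).const_mul _).add (hinner.const_mul _))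
          (.of_forall fun a => (cosh_norm_add_le x (g a)).trans ?_)
        have h := (abs_le.1 (Real.abs_exp_sub_one_sub_id_le (x := ‖g a‖)
          (by rw [abs_norm]; exact hg1 a))).2
        have h' : Real.exp ‖g a‖ - ‖g a‖ ≤ 1 + ‖g a‖ ^ 2 := by linarith
        exact add_le_add_left (mul_le_mul_of_nonneg_left h' (Real.cosh_pos _).le) _
    _ = Real.cosh ‖x‖ * (1 + ∫ a, ‖g a‖ ^ 2 ∂ν) := by
        have h1 : Integrable (fun a => 1 + ‖g a‖ ^ 2) ν := (integrable_const 1).add hsq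
        rw [integral_add (h1.const_mul _) (hinner.const_mul _), integral_const_mul, integral_const_mul, hinner0,
          integral_add (integrable_const 1) hsq]
        simp
    _ ≤ Real.cosh ‖x‖ * Real.exp V := by
        gcongr
        linarith [Real.add_one_le_exp V]

/-- The starting point `x` is arbitrary so that the induction can absorb the first sample into it.
-/
theorem lintegral_cosh_norm_add_sum_le (hg : StronglyMeasurable g) (hg1 : ∀ a, ‖g a‖ ≤ 1)
    (hmean : ∫ a, g a ∂ν = 0) (hV : ∫ a, ‖g a‖ ^ 2 ∂ν ≤ V) (n : ℕ) (x : E) :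
    ∫⁻ y, ENNReal.ofReal (Real.cosh ‖x + ∑ i, g (y i)‖) ∂(Measure.pi fun _ : Fin n => ν) ≤
      ENNReal.ofReal (Real.cosh ‖x‖ * Real.exp (n * V)) := by
  induction n generalizing x with
  | zero => simp
  | succ n ih =>
    have hmeas : Measurable fun p : α × (Fin n → α) =>
        ENNReal.ofReal (Real.cosh ‖x + g p.1 + ∑ i, g (p.2 i)‖) := by
      have hs : StronglyMeasurable fun p : α × (Fin n → α) => x + g p.1 + ∑ i, g (p.2 i) :=
        (stronglyMeasurable_const.add (hg.comp_measurable measurable_fst)).add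
          (Finset.stronglyMeasurable_fun_sum _ fun i _ =>
            hg.comp_measurable ((measurable_pi_apply i).comp measurable_snd))
      exact (Real.measurable_cosh.comp hs.norm.measurable).ennreal_ofReal
    have hmp := measurePreserving_piFinSuccAbove (fun _ : Fin (n + 1) => ν) 0
    have hcosh : Integrable (fun a => Real.cosh ‖x + g a‖) ν := by
      refine .of_bound (Real.measurable_cosh.comp
        (stronglyMeasurable_const.add hg).norm.measurable).aestronglyMeasurable
        (Real.cosh (‖x‖ + 1)) (.of_forall fun a => ?_)
      rw [Real.norm_of_nonneg (Real.cosh_pos _).le, Real.cosh_le_cosh, abs_norm,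
        abs_of_nonneg (by positivity)]
      exact (norm_add_le _ _).trans (by gcongr; exact hg1 a)
    calc ∫⁻ y, ENNReal.ofReal (Real.cosh ‖x + ∑ i, g (y i)‖) ∂(Measure.pi fun _ => ν)
        = ∫⁻ p, ENNReal.ofReal (Real.cosh ‖x + g p.1 + ∑ i, g (p.2 i)‖)
            ∂(ν.prod (Measure.pi fun _ : Fin n => ν)) := by
          rw [← hmp.lintegral_comp hmeas]
          simp only [Fin.sum_univ_succ, add_assoc]
          rfl
      _ = ∫⁻ a, ∫⁻ y, ENNReal.ofReal (Real.cosh ‖x + g a + ∑ i, g (y i)‖)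
            ∂(Measure.pi fun _ : Fin n => ν) ∂ν := lintegral_prod _ hmeas.aemeasurable
      _ ≤ ∫⁻ a, ENNReal.ofReal (Real.cosh ‖x + g a‖ * Real.exp (n * V)) ∂ν :=
          lintegral_mono fun a => ih _
      _ = ENNReal.ofReal ((∫ a, Real.cosh ‖x + g a‖ ∂ν) * Real.exp (n * V)) := by
          rw [← integral_mul_const, ofReal_integral_eq_lintegral_ofReal (hcosh.mul_const _)
            (.of_forall fun a => by positivity)]
      _ ≤ ENNReal.ofReal (Real.cosh ‖x‖ * Real.exp ((n + 1 : ℕ) * V)) := by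
          refine ENNReal.ofReal_le_ofReal ?_
          calc _ ≤ Real.cosh ‖x‖ * Real.exp V * Real.exp (n * V) := by
                gcongr; exact integral_cosh_norm_add_le hg hg1 hmean hV x
            _ = _ := by rw [mul_assoc, ← Real.exp_add]; push_cast; ring_nf

theorem measureReal_pi_le_norm_sum_le (hg : StronglyMeasurable g) (hg1 : ∀ a, ‖g a‖ ≤ 1)
    (hmean : ∫ a, g a ∂ν = 0) (hV : ∫ a, ‖g a‖ ^ 2 ∂ν ≤ V) (n : ℕ) (t : ℝ) :
    (Measure.pi fun _ : Fin n => ν).real {y | t ≤ ‖∑ i, g (y i)‖} ≤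
      2 * Real.exp (n * V - t) := by
  have hs : StronglyMeasurable fun y : Fin n → α => ∑ i, g (y i) :=
    Finset.stronglyMeasurable_fun_sum _ fun i _ => hg.comp_measurable (measurable_pi_apply i)
  have hmeas : Measurable fun y : Fin n → α => ENNReal.ofReal (Real.cosh ‖∑ i, g (y i)‖) :=
    (Real.measurable_cosh.comp hs.norm.measurable).ennreal_ofReal
  have hle := lintegral_cosh_norm_add_sum_le hg hg1 hmean hV n 0
  simp only [zero_add, norm_zero, Real.cosh_zero, one_mul] at hle
  have hmarkov := (mul_meas_ge_le_lintegral₀ (μ := Measure.pi fun _ : Fin n => ν)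
    hmeas.aemeasurable (ENNReal.ofReal (Real.exp t / 2))).trans hle
  have hsub : {y : Fin n → α | t ≤ ‖∑ i, g (y i)‖} ⊆
      {y | ENNReal.ofReal (Real.exp t / 2) ≤ ENNReal.ofReal (Real.cosh ‖∑ i, g (y i)‖)} := by
    intro y hy
    refine ENNReal.ofReal_le_ofReal ?_
    rw [Real.cosh_eq]
    have := Real.exp_le_exp.2 hy
    have := Real.exp_pos (-‖∑ i, g (y i)‖)
    linarith
  have h := ENNReal.toReal_mono ENNReal.ofReal_ne_top
    ((mul_le_mul_right (measure_mono hsub) _).trans hmarkov)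
  rw [ENNReal.toReal_mul, ENNReal.toReal_ofReal (by positivity),
    ENNReal.toReal_ofReal (by positivity)] at h
  rw [Real.exp_sub, mul_div_assoc', le_div_iff₀ (Real.exp_pos t)]
  rw [measureReal_def]
  linarith

end Concentration

/-! ### Trace norm, Hilbert–Schmidt norm and operator order. -/

section Operators

variable {H : Type*} [NormedAddCommGroup H] [InnerProductSpace ℂ H] {ι : Type*} [Fintype ι]

/-- The trace, as a continuous linear functional on operators. -/
noncomputable def traceCLM (H : Type*) [NormedAddCommGroup H] [InnerProductSpace ℂ H]
    [FiniteDimensional ℂ H] : (H →L[ℂ] H) →L[ℂ] ℂ :=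
  LinearMap.toContinuousLinearMap (LinearMap.trace ℂ H ∘ₗ ContinuousLinearMap.coeLM ℂ)

/-- The columns of an operator in an orthonormal basis; the norm of the target is the
Hilbert–Schmidt norm. -/
noncomputable def columns [FiniteDimensional ℂ H] (b : OrthonormalBasis ι ℂ H) :
    (H →L[ℂ] H) →L[ℂ] PiLp 2 (fun _ : ι => H) :=
  LinearMap.toContinuousLinearMap
    { toFun := fun A => WithLp.toLp 2 fun i => A (b i)
      map_add' := fun _ _ => rfl
      map_smul' := fun _ _ => rfl }

theorem norm_columns_sq [FiniteDimensional ℂ H] (b : OrthonormalBasis ι ℂ H) (A : H →L[ℂ] H) :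
    ‖columns b A‖ ^ 2 = ∑ i, ‖A (b i)‖ ^ 2 :=
  PiLp.norm_sq_eq_of_L2 _ _

theorem re_trace_eq_sum_inner (b : OrthonormalBasis ι ℂ H) (A : H →L[ℂ] H) :
    (LinearMap.trace ℂ H A.toLinearMap).re = ∑ i, (inner ℂ (b i) (A (b i))).re := by
  rw [LinearMap.trace_eq_sum_inner _ b, Complex.re_sum]
  rfl

theorem re_trace_le_of_le_smul_one [FiniteDimensional ℂ H] {A : H →L[ℂ] H} {c : ℝ}
    (hAc : A ≤ (c : ℂ) • (1 : H →L[ℂ] H)) :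
    (LinearMap.trace ℂ H A.toLinearMap).re ≤ c * Module.finrank ℂ H := by
  rw [re_trace_eq_sum_inner (stdOrthonormalBasis ℂ H)]
  calc _ ≤ ∑ _i : Fin (Module.finrank ℂ H), c := by
        gcongr with i
        have h := (ContinuousLinearMap.le_def _ _).1 hAc |>.re_inner_nonneg_right
          (stdOrthonormalBasis ℂ H i)
        simp only [sub_apply, smul_apply,
          one_apply_eq_self, inner_sub_right, inner_smul_right, map_sub,
          RCLike.re_to_complex, Complex.re_ofReal_mul, inner_self_eq_norm_sq_to_K,
          OrthonormalBasis.norm_eq_one] at h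
        simp at h
        exact h
    _ = _ := by simp [mul_comm]

variable [CompleteSpace H]

theorem norm_abs_apply (A : H →L[ℂ] H) (v : H) : ‖(CFC.abs A) v‖ = ‖A v‖ := by
  have hsa : ContinuousLinearMap.adjoint (CFC.abs A) = CFC.abs A :=
    (CFC.abs_nonneg A).isSelfAdjoint.star_eq
  have h : ‖(CFC.abs A) v‖ ^ 2 = ‖A v‖ ^ 2 := by
    rw [ContinuousLinearMap.apply_norm_sq_eq_inner_adjoint_left,
      ContinuousLinearMap.apply_norm_sq_eq_inner_adjoint_left, hsa]
    have hm : CFC.abs A * CFC.abs A = ContinuousLinearMap.adjoint A * A := CFC.abs_mul_abs A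
    exact congrArg (fun T : H →L[ℂ] H => RCLike.re (inner ℂ (T v) v)) hm
  exact (sq_eq_sq₀ (norm_nonneg _) (norm_nonneg _)).1 h

theorem traceNorm_of_nonneg {A : H →L[ℂ] H} (hA : 0 ≤ A) :
    traceNorm A = (LinearMap.trace ℂ H A.toLinearMap).re := by
  rw [traceNorm, CFC.abs_of_nonneg A hA]

theorem traceNorm_le_sqrt_card_mul [FiniteDimensional ℂ H] (b : OrthonormalBasis ι ℂ H)
    (A : H →L[ℂ] H) : traceNorm A ≤ √(Fintype.card ι) * ‖columns b A‖ := by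
  rw [traceNorm, re_trace_eq_sum_inner b]
  calc ∑ i, (inner ℂ (b i) (CFC.abs A (b i))).re ≤ ∑ i, 1 * ‖A (b i)‖ := by
        gcongr with i
        refine (Complex.re_le_norm _).trans ((norm_inner_le_norm _ _).trans ?_)
        rw [b.norm_eq_one, norm_abs_apply]
    _ ≤ √(∑ _i : ι, 1 ^ 2) * √(∑ i, ‖A (b i)‖ ^ 2) := Real.sum_mul_le_sqrt_mul_sqrt _ _ _
    _ = _ := by rw [← norm_columns_sq, Real.sqrt_sq (norm_nonneg _)]; simp

/-- This is `A² ≤ c A`, obtained by testing `A ≤ c` on the vector `√A v`. -/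
theorem norm_apply_sq_le {A : H →L[ℂ] H} {c : ℝ} (hA : 0 ≤ A)
    (hAc : A ≤ (c : ℂ) • (1 : H →L[ℂ] H)) (v : H) :
    ‖A v‖ ^ 2 ≤ c * (inner ℂ v (A v)).re := by
  set B := CFC.sqrt A
  have hB : ContinuousLinearMap.adjoint B = B := (CFC.sqrt_nonneg A).isSelfAdjoint.star_eq
  have hBB : ∀ w, B (B w) = A w := fun w => DFunLike.congr_fun (CFC.sqrt_mul_sqrt_self A hA) w
  have hsymm : ∀ u w, inner ℂ (B u) w = inner ℂ u (B w) := fun u w => by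
    rw [← ContinuousLinearMap.adjoint_inner_right, hB]
  have h := (ContinuousLinearMap.le_def _ _).1 hAc |>.re_inner_nonneg_right (B v)
  simp only [sub_apply, smul_apply,
    one_apply_eq_self, inner_sub_right, inner_smul_right, map_sub,
    RCLike.re_to_complex, Complex.re_ofReal_mul] at h
  have h1 : inner ℂ (B v) (B v) = inner ℂ v (A v) := by rw [hsymm, hBB]
  have h2 : (inner ℂ (B v) (A (B v))).re = ‖A v‖ ^ 2 := by
    rw [← hBB (B v), ← hsymm, hBB, ← RCLike.re_to_complex, inner_self_eq_norm_sq]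
  rw [h1, h2] at h
  linarith

theorem norm_columns_sq_le [FiniteDimensional ℂ H] (b : OrthonormalBasis ι ℂ H)
    {A : H →L[ℂ] H} {c : ℝ} (hA : 0 ≤ A) (hAc : A ≤ (c : ℂ) • (1 : H →L[ℂ] H)) :
    ‖columns b A‖ ^ 2 ≤ c * (LinearMap.trace ℂ H A.toLinearMap).re := by
  rw [norm_columns_sq, re_trace_eq_sum_inner b, Finset.mul_sum]
  gcongr with i
  exact norm_apply_sq_le hA hAc _

end Operators

/-! ### Concentration in trace norm. -/

section Main

variable {H : Type*} [NormedAddCommGroup H] [InnerProductSpace ℂ H] [CompleteSpace H]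

theorem norm_le_of_le_smul_one {A : H →L[ℂ] H} {c : ℝ} (hc : 0 ≤ c) (hA : 0 ≤ A)
    (hAc : A ≤ (c : ℂ) • (1 : H →L[ℂ] H)) : ‖A‖ ≤ c := by
  refine (CStarAlgebra.norm_le_norm_of_nonneg_of_le hA hAc).trans ?_
  rw [norm_smul, Complex.norm_real, Real.norm_of_nonneg hc]
  exact mul_le_of_le_one_right hc ContinuousLinearMap.norm_id_le

variable [FiniteDimensional ℂ H]

theorem norm_columns_le {ι : Type*} [Fintype ι] (b : OrthonormalBasis ι ℂ H) {A : H →L[ℂ] H}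
    {c : ℝ} (hc : 0 ≤ c) (hA : 0 ≤ A) (hAc : A ≤ (c : ℂ) • (1 : H →L[ℂ] H)) :
    ‖columns b A‖ ≤ c * √(Module.finrank ℂ H) := by
  refine abs_le_of_sq_le_sq' ?_ (by positivity) |>.2
  rw [mul_pow, Real.sq_sqrt (Nat.cast_nonneg _), sq c, mul_assoc]
  exact (norm_columns_sq_le b hA hAc).trans (by gcongr; exact re_trace_le_of_le_smul_one hAc)

/-- Trace-norm concentration of the sum of `M` independent operators with common law, with a
bound free of the dimension. -/
theorem measureReal_pi_traceNorm_sampleAverage_sub_gt_le {α : Type*} [MeasurableSpace α]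
    {ν : Measure α} [IsProbabilityMeasure ν] {σ : α → H →L[ℂ] H} (hσ : StronglyMeasurable σ)
    {c : ℝ} (hc : 0 < c) (hσ_nonneg : ∀ x, 0 ≤ σ x)
    (hσ_le : ∀ x, σ x ≤ (c : ℂ) • (1 : H →L[ℂ] H)) (hd : 0 < Module.finrank ℂ H)
    {ε δ : ℝ} (hε : 0 < ε) (hε2 : ε ≤ 1 / 2) (M : ℕ) :
    (Measure.pi fun _ : Fin M => ν).real
        {y | ε * (traceNorm (∫ x, σ x ∂ν) + δ * Module.finrank ℂ H) <
          traceNorm (sampleAverage (fun m => σ (y m)) - ∫ x, σ x ∂ν)} ≤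
      2 * Real.exp (-(ε ^ 2 * M * (δ / c))) := by
  set d : ℝ := ((Module.finrank ℂ H : ℕ) : ℝ)
  have hd0 : 0 < d := Nat.cast_pos.2 hd
  set s := ∫ x, σ x ∂ν with hs
  set b := stdOrthonormalBasis ℂ H
  set Λ := columns b
  -- Centred columns have norm at most `2 * c * √d`, so this scaling bounds the increments by `2 * ε
  -- ≤ 1`.
  set θ := ε / (c * √d) with hθ
  have hθ0 : 0 < θ := by positivity
  have hσ_int : Integrable σ ν := .of_bound hσ.aestronglyMeasurable c
    (.of_forall fun x => norm_le_of_le_smul_one hc.le (hσ_nonneg x) (hσ_le x))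
  have hΛσ : ∀ x, ‖Λ (σ x)‖ ≤ c * √d := fun x =>
    norm_columns_le b hc.le (hσ_nonneg x) (hσ_le x)
  have hΛσ_meas : StronglyMeasurable fun x => Λ (σ x) := Λ.continuous.comp_stronglyMeasurable hσ
  have hΛσ_int : Integrable (fun x => Λ (σ x)) ν := Λ.integrable_comp hσ_int
  have hΛs : ∫ x, Λ (σ x) ∂ν = Λ s := Λ.integral_comp_comm hσ_int
  have hΛs_le : ‖Λ s‖ ≤ c * √d := by
    rw [← hΛs]
    simpa using norm_integral_le_of_norm_le_const (μ := ν) (.of_forall hΛσ)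
  have hsq_int : Integrable (fun x => ‖Λ (σ x)‖ ^ 2) ν :=
    .of_bound (hΛσ_meas.norm.pow 2).aestronglyMeasurable ((c * √d) ^ 2) (.of_forall fun x => by
      rw [norm_pow, norm_norm]; gcongr; exact hΛσ x)
  have hτ : traceNorm s = ∫ x, (LinearMap.trace ℂ H (σ x).toLinearMap).re ∂ν := by
    rw [traceNorm_of_nonneg (integral_nonneg hσ_nonneg)]
    have h1 : ∫ x, traceCLM H (σ x) ∂ν = traceCLM H s :=
      (traceCLM H).integral_comp_comm hσ_int
    have h2 := integral_re ((traceCLM H).integrable_comp hσ_int)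
    rw [h1] at h2
    exact h2.symm
  have hsq_le : ∫ x, ‖Λ (σ x)‖ ^ 2 ∂ν ≤ c * traceNorm s := by
    rw [hτ, ← integral_const_mul]
    exact integral_mono hsq_int (((traceCLM H).integrable_comp hσ_int).re.const_mul c)
      fun x => norm_columns_sq_le b (hσ_nonneg x) (hσ_le x)
  have hvar : ∫ x, ‖Λ (σ x) - Λ s‖ ^ 2 ∂ν ≤ c * traceNorm s := by
    rw [← hΛs]
    exact (integral_norm_sub_integral_sq_le hΛσ_int hsq_int).trans hsq_le
  have hnorm : ∀ v : PiLp 2 (fun _ : Fin (Module.finrank ℂ H) => H), ‖(θ : ℂ) • v‖ = θ * ‖v‖ :=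
    fun v => by rw [norm_smul, Complex.norm_real, Real.norm_of_nonneg hθ0.le]
  have hconc := measureReal_pi_le_norm_sum_le (ν := ν)
    (g := fun x => (θ : ℂ) • (Λ (σ x) - Λ s)) (V := θ ^ 2 * (c * traceNorm s))
    ((hΛσ_meas.sub stronglyMeasurable_const).const_smul (θ : ℂ))
    (fun x => by
      rw [hnorm]
      calc θ * ‖Λ (σ x) - Λ s‖ ≤ θ * (c * √d + c * √d) := by
            gcongr
            exact (norm_sub_le _ _).trans (add_le_add (hΛσ x) hΛs_le)
        _ = 2 * ε := by rw [hθ]; field_simp; ring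
        _ ≤ 1 := by linarith)
    (by rw [integral_smul, integral_sub hΛσ_int (integrable_const _), hΛs]; simp)
    (by
      simp only [hnorm, mul_pow]
      rw [integral_const_mul]
      gcongr)
    M (θ * (M * (ε * (traceNorm s + δ * d) / √d)))
  refine (measureReal_mono ?_).trans (hconc.trans_eq ?_)
  · intro y hy
    have hdev : (∑ m, (θ : ℂ) • (Λ (σ (y m)) - Λ s)) =
        (θ : ℂ) • ((M : ℂ) • Λ (sampleAverage (fun m => σ (y m)) - s)) := by
      rw [← Finset.smul_sum, Finset.sum_sub_distrib, ← map_smul Λ, smul_sub (M : ℂ),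
        sampleAverage]
      rcases eq_or_ne M 0 with rfl | hM
      · simp
      · rw [smul_inv_smul₀ (Nat.cast_ne_zero.2 hM)]
        rw [Nat.cast_smul_eq_nsmul ℂ M s, map_sub, map_sum, map_nsmul, Finset.sum_const,
          Finset.card_univ, Fintype.card_fin]
    simp only [Set.mem_ofPred_eq] at hy ⊢
    rw [hdev, hnorm, norm_smul, Complex.norm_natCast]
    gcongr
    rw [div_le_iff₀' (Real.sqrt_pos.2 hd0)]
    have h := traceNorm_le_sqrt_card_mul b (sampleAverage (fun m => σ (y m)) - s)
    rw [Fintype.card_fin] at h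
    exact hy.le.trans h
  -- Both `θ² c` and `θ ε / √d` equal `ε² / (c d)`, so the trace terms cancel.
  · congr 2
    have hsqrt : √d ^ 2 = d := Real.sq_sqrt hd0.le
    have h1 : θ ^ 2 * c = ε ^ 2 / (c * d) := by rw [hθ, div_pow, mul_pow, hsqrt]; field_simp
    have h2 : θ * (ε / √d) = ε ^ 2 / (c * d) := by rw [hθ]; field_simp; rw [hsqrt]
    calc _ = M * ((θ ^ 2 * c) * traceNorm s - (θ * (ε / √d)) * (traceNorm s + δ * d)) := by ring
      _ = _ := by rw [h1, h2]; field_simp; ring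

end Main

theorem lemma3
    {H : Type*} [NormedAddCommGroup H] [InnerProductSpace ℂ H] [CompleteSpace H]
    [FiniteDimensional ℂ H]
    -- the random variable `X` with values in `𝒳`
    {𝒳 : Type*} [MeasurableSpace 𝒳]
    {Ω₀ : Type*} [MeasurableSpace Ω₀] (P₀ : Measure Ω₀) [IsProbabilityMeasure P₀]
    (X : Ω₀ → 𝒳) (hX : Measurable X)
    -- the operators `σ_x`
    (σ : 𝒳 → H →L[ℂ] H) (hσ : Measurable σ)
    (lam : ℝ) (hσ_nonneg : ∀ x, 0 ≤ σ x)
    (hσ_le : ∀ x, σ x ≤ (lam : ℂ) • (1 : H →L[ℂ] H))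
    -- `M` independent samples, each distributed as `X`
    {Ω : Type*} [MeasurableSpace Ω] (P : Measure Ω) [IsProbabilityMeasure P]
    (M : ℕ) (Xs : Fin M → Ω → 𝒳) (hXs_meas : ∀ m, Measurable (Xs m))
    (hXs_indep : iIndepFun Xs P) (hXs_law : ∀ m, IdentDistrib (Xs m) X P P₀)
    (ε δ : ℝ) (hε : 0 < ε) (hδ : 0 < δ) (hεlt : ε < min (1 / 2) (lam / δ)) :
    1 - 2 * (Module.finrank ℂ H : ℝ) *
        Real.exp (-ε ^ 2 * (M : ℝ) / (2 * Real.log 2) * (δ / (lam + δ))) ≤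
      P.real {ω | traceNorm (sampleAverage (fun m => σ (Xs m ω)) - ∫ w, σ (X w) ∂P₀) ≤
        ε * (traceNorm (∫ w, σ (X w) ∂P₀) + δ * (Module.finrank ℂ H : ℝ))} := by
  -- In dimension zero the claimed lower bound is 1, so the event must be certain; it is, as all
  -- trace norms vanish.
  rcases Nat.eq_zero_or_pos (Module.finrank ℂ H) with hd | hd
  · have : Subsingleton H := Module.finrank_zero_iff.1 hd
    have h0 : ∀ A : H →L[ℂ] H, traceNorm A = 0 := fun A => by
      rw [traceNorm, Subsingleton.elim (CFC.abs A) 0]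
      simp
    simp [h0, hd]
  have hlam : 0 < lam := by
    have := hε.trans (hεlt.trans_le (min_le_right _ _))
    exact (div_pos_iff_of_pos_right hδ).1 this
  have hε2 : ε ≤ 1 / 2 := (hεlt.trans_le (min_le_left _ _)).le
  have : ProperSpace (H →L[ℂ] H) := FiniteDimensional.proper ℂ _
  have hσ' : StronglyMeasurable σ := hσ.stronglyMeasurable
  have hν : IsProbabilityMeasure (P₀.map X) := Measure.isProbabilityMeasure_map hX.aemeasurable
  have hmean : ∫ w, σ (X w) ∂P₀ = ∫ x, σ x ∂(P₀.map X) :=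
    (integral_map hX.aemeasurable hσ'.aestronglyMeasurable).symm
  have hXs : Measurable fun ω m => Xs m ω := measurable_pi_lambda _ hXs_meas
  have hlaw : P.map (fun ω m => Xs m ω) = Measure.pi fun _ : Fin M => P₀.map X := by
    rw [(iIndepFun_iff_map_fun_eq_pi_map fun m => (hXs_meas m).aemeasurable).1 hXs_indep]
    simp_rw [fun m => (hXs_law m).map_eq]
  have htail := measureReal_pi_traceNorm_sampleAverage_sub_gt_le (ν := P₀.map X) hσ' hlam
    hσ_nonneg hσ_le hd hε hε2 (δ := δ) M
  rw [← hlaw, ← hmean] at htail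
  set G := {ω | traceNorm (sampleAverage (fun m => σ (Xs m ω)) - ∫ w, σ (X w) ∂P₀) ≤
        ε * (traceNorm (∫ w, σ (X w) ∂P₀) + δ * (Module.finrank ℂ H : ℝ))}
  have hcompl : P.real Gᶜ ≤ 2 * Real.exp (-(ε ^ 2 * M * (δ / lam))) := by
    refine le_trans ?_ htail
    have := Measure.isProbabilityMeasure_map (μ := P) hXs.aemeasurable
    refine ENNReal.toReal_mono (measure_ne_top _ _)
      ((measure_mono fun ω hω => ?_).trans (Measure.le_map_apply hXs.aemeasurable _))
    simp only [G, Set.mem_compl_iff, Set.mem_ofPred_eq, not_le] at hω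
    exact hω
  have hunion : 1 ≤ P.real G + P.real Gᶜ := by
    rw [← probReal_univ (μ := P), ← Set.union_compl_self G]
    exact measureReal_union_le _ _
  -- The weaker stated exponent follows from `2 * log 2 ≥ 1` and `lam ≤ lam + δ`.
  have hexp : Real.exp (-(ε ^ 2 * M * (δ / lam))) ≤
      Real.exp (-ε ^ 2 * (M : ℝ) / (2 * Real.log 2) * (δ / (lam + δ))) := by
    rw [Real.exp_le_exp, neg_mul, neg_div, neg_mul, neg_le_neg_iff]
    have hlog : 1 ≤ 2 * Real.log 2 := by linarith [Real.log_two_gt_d9]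
    gcongr
    · exact div_le_self (by positivity) hlog
    · linarith
  have hd1 : (1 : ℝ) ≤ Module.finrank ℂ H := Nat.one_le_cast.2 hd
  have : 2 * Real.exp (-(ε ^ 2 * M * (δ / lam))) ≤ 2 * (Module.finrank ℂ H : ℝ) *
      Real.exp (-ε ^ 2 * (M : ℝ) / (2 * Real.log 2) * (δ / (lam + δ))) := by
    gcongr
    linarith
  linarith
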